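/- Let $P$ be a Laurent polynomial with integer coefficients in $r\ge 0$ variables and let $p$ be a prime. Write $\mathrm{ct}[F]$ for the constant term of a Laurent polynomial $F$, let $\deg P$ be the largest absolute value of an exponent of a single variable in $P$ (with $\deg P=0$ if there is none), put $m=\max(\deg P-1,0)$ and $$B_{P,p}=p^{\,p^{(2m+1)^r}}.$$ A sequence $(s_n)_{n\ge 0}$ is called linearly recurrent if there is a constant $K$ such that, for every nonempty word $w=s_is_{i+1}\cdots s_{i+\ell-1}$ in it, every occurrence of $w$ is followed by another occurrence of $w$ at a distance of at most $K\ell$. The frequency of a value $c$ in $(s_n)$ is the asymptotic density of $\{n\ge 0 : s_n=c\}$. (1) We have $p\nmid \mathrm{ct}[P^n]$ for all $n\ge 0$ if and only if $p\nmid \mathrm{ct}[P^n]$ for all $0\le n<B_{P,p}$. (2) For every integer Laurent polynomial $Q$ in the same variables and every $a\ge 1$: if the sequence $\left(\mathrm{ct}[P^nQ]\bmod p^a\right)_{n\ge 0}$ is not identically $0$, then it is linearly recurrent if and only if $p\nmid \mathrm{ct}[P^n]$ for all $n\ge 0$. (3) For every integer Laurent polynomial $Q$ in the same variables and every $a\ge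 1$, also when the sequence is identically $0$: if $p\nmid \mathrm{ct}[P^n]$ for all $n\ge 0$, then $\left(\mathrm{ct}[P^nQ]\bmod p^a\right)_{n\ge 0}$ is linearly recurrent; if $p\mid \mathrm{ct}[P^n]$ for some $n\ge 0$, then $0$ has frequency $1$ in it. In particular, whenever the sequence is not linearly recurrent, $0$ has frequency $1$ in it. Thus, apart from sequences that are identically $0$, which of the two cases occurs depends only on $P$ and $p$, and not on $Q$ or on $a$. -/

import Mathlib

open Filter Topology

/-- Laurent polynomials with integer coefficients in `r` variables: the exponent vector of a
monomial is an element of `Fin r → ℤ`. -/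
abbrev IntLaurent (r : ℕ) : Type := AddMonoidAlgebra ℤ (Fin r → ℤ)

namespace IntLaurent

/-- The constant term of a Laurent polynomial. -/
def ct {r : ℕ} (P : IntLaurent r) : ℤ := P.coeff 0

/-- The degree of a Laurent polynomial: the largest absolute value of an exponent of a single
variable in it (and `0` if there is none). -/
def deg {r : ℕ} (P : IntLaurent r) : ℕ :=
  P.coeff.support.sup fun k => Finset.univ.sup fun i => (k i).natAbs

/-- The sequence `n ↦ ct (P ^ n * Q)` modulo `N`. -/
noncomputable def ctSeq {r : ℕ} (P Q : IntLaurent r) (N : ℕ) (n : ℕ) : ZMod N := (ct (P ^ n * Q) : ZMod N)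

/-- The bound `p ^ (p ^ ((2 * m + 1) ^ r))`, where `m = max (deg P - 1) 0` (the subtraction below is
truncated). For `1 ≤ deg P` it equals `p ^ (p ^ ((2 * deg P - 1) ^ r))`. -/
def checkBound {r : ℕ} (P : IntLaurent r) (p : ℕ) : ℕ :=
  p ^ (p ^ ((2 * (deg P - 1) + 1) ^ r))

end IntLaurent

/-- The word `s i, s (i + 1), …, s (i + ℓ - 1)` of the sequence `s` occurs in `s` at position `j`. -/
def WordOccursAt {α : Type*} (s : ℕ → α) (i ℓ j : ℕ) : Prop :=
  ∀ k < ℓ, s (j + k) = s (i + k)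

/-- Every occurrence of the word `s i, …, s (i + ℓ - 1)` in `s` is followed by another occurrence of
it, at a distance of at most `C`. -/
def WordGapBound {α : Type*} (s : ℕ → α) (i ℓ C : ℕ) : Prop :=
  ∀ j, WordOccursAt s i ℓ j → ∃ d, 0 < d ∧ d ≤ C ∧ WordOccursAt s i ℓ (j + d)

/-- A sequence is linearly recurrent if there is a constant `K` such that every occurrence of every
nonempty word `w` is followed by another occurrence of `w`, at a distance of at most `K * |w|`. -/
def IsLinearlyRecurrent {α : Type*} (s : ℕ → α) : Prop :=
  ∃ K : ℕ, ∀ i ℓ : ℕ, 0 < ℓ → WordGapBound s i ℓ (K * ℓ)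

/-- The value `c` has frequency `δ` in the sequence `s`: the set `{n | s n = c}` has asymptotic
density `δ`. -/
def HasFrequency {α : Type*} (s : ℕ → α) (c : α) (δ : ℝ) : Prop :=
  Tendsto (fun N : ℕ => (Set.ncard {n : ℕ | n < N ∧ s n = c} : ℝ) / (N : ℝ)) atTop (𝓝 δ)

/-! Modulo p^a, the power R = P^(p^(a-1)) satisfies R^p = R(x^p) (`frobeniusFixed_reduce`). Base-p
digits of the exponent can therefore be peeled off: ct(R^(p^M z + t) Q) = ct(R^z Λ(R^t Q)), with Λ
the Cartier operator (`FrobeniusFixed.constTerm_split`). For t < p^M the new factor stays in a box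
independent of M and t, so only finitely many occur. If z is separated from t by enough zero digits,
this factor is a constant and the value is ct(R^z) ct(R^t Q).

If p divides some ct(P^n), a power of ct(R^n) vanishes mod p^a and is itself some ct(R^m). The
digits of m, padded with zeros, form a block that forces the value 0 wherever it occurs, and it
occurs for a set of density 1. A linearly recurrent sequence with a value of frequency 1 is
constant, which settles the converse.

Otherwise every ct(R^z) is a unit, and its inverse is ct(R^m) with m bounded. Inserting the digits
of m cancels the high part z, so each functional Q ↦ ct(R^x Q) on a box recurs with bounded gaps.
This functional determines a whole block of the sequence, whence linear recurrence. The bound in (1)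
comes from the pigeonhole principle applied to the peeled factors mod p. -/

namespace LaurentCT

/-! ### Cartier operator and splitting of base-p digits -/

section Algebra

open AddMonoidAlgebra

variable {A : Type*} [CommRing A] {r : ℕ}

/-- The constant term as an additive map, over an arbitrary coefficient ring. -/
noncomputable def constTerm (f : AddMonoidAlgebra A (Fin r → ℤ)) : A := f.coeff 0

/-- The substitution `x ↦ x ^ q`. -/
noncomputable def expand (q : ℕ) :
    AddMonoidAlgebra A (Fin r → ℤ) →+* AddMonoidAlgebra A (Fin r → ℤ) :=
  mapDomainRingHom A (nsmulAddMonoidHom (α := Fin r → ℤ) q)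

theorem smul_injective_of_neZero (q : ℕ) [NeZero q] :
    Function.Injective fun g : Fin r → ℤ => q • g := by
  intro g h hgh
  funext i
  have := congrFun hgh i
  simpa [NeZero.ne q] using this

/-- The Cartier operator, which keeps the monomials that are `q`-th powers and takes their roots. -/
noncomputable def cartier (q : ℕ) [NeZero q] :
    AddMonoidAlgebra A (Fin r → ℤ) →+ AddMonoidAlgebra A (Fin r → ℤ) :=
  comapDomainAddMonoidHom (fun g => q • g) (smul_injective_of_neZero q)

/-- All exponents of `f` are bounded by `D` in absolute value. -/
def InBox (f : AddMonoidAlgebra A (Fin r → ℤ)) (D : ℕ) : Prop :=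
  ∀ g, f.coeff g ≠ 0 → ∀ i, |g i| ≤ (D : ℤ)

theorem expand_single (q : ℕ) (g : Fin r → ℤ) (c : A) :
    expand q (single g c) = single (q • g) c := by
  simp [expand]

theorem expand_expand (q q' : ℕ) (f : AddMonoidAlgebra A (Fin r → ℤ)) :
    expand q (expand q' f) = expand (q * q') f := by
  induction f using AddMonoidAlgebra.induction_linear with
  | zero => simp
  | add f g hf hg => simp [hf, hg]
  | single g c => simp [expand_single, mul_smul]

theorem expand_one (f : AddMonoidAlgebra A (Fin r → ℤ)) : expand 1 f = f := by
  induction f using AddMonoidAlgebra.induction_linear with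
  | zero => simp
  | add f g hf hg => simp [hf, hg]
  | single g c => simp [expand_single]

theorem coeff_cartier (q : ℕ) [NeZero q] (f : AddMonoidAlgebra A (Fin r → ℤ)) (g : Fin r → ℤ) :
    (cartier q f).coeff g = f.coeff (q • g) := by
  simp [cartier, comapDomainAddMonoidHom]

theorem constTerm_cartier (q : ℕ) [NeZero q] (f : AddMonoidAlgebra A (Fin r → ℤ)) :
    constTerm (cartier q f) = constTerm f := by
  simp [constTerm, coeff_cartier]

theorem cartier_expand_mul (q : ℕ) [NeZero q] (f g : AddMonoidAlgebra A (Fin r → ℤ)) :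
    cartier q (expand q f * g) = f * cartier q g := by
  induction f using AddMonoidAlgebra.induction_linear with
  | zero => simp
  | add f f' hf hf' => simp [add_mul, hf, hf']
  | single a c =>
    ext m
    rw [expand_single, coeff_cartier, coeff_single_mul_apply, coeff_single_mul_apply,
      coeff_cartier, smul_add, smul_neg]

theorem constTerm_one : constTerm (1 : AddMonoidAlgebra A (Fin r → ℤ)) = 1 := by
  simp [constTerm]

theorem InBox.mono {f : AddMonoidAlgebra A (Fin r → ℤ)} {D E : ℕ} (h : InBox f D) (hDE : D ≤ E) :
    InBox f E :=
  fun g hg i => (h g hg i).trans (by exact_mod_cast hDE)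

theorem inBox_one : InBox (1 : AddMonoidAlgebra A (Fin r → ℤ)) 0 := by
  classical
  intro g hg i
  have : g = 0 := by
    by_contra h
    exact hg (by simp [AddMonoidAlgebra.one_def, Ne.symm h])
  simp [this]

theorem InBox.mul {f g : AddMonoidAlgebra A (Fin r → ℤ)} {D E : ℕ} (hf : InBox f D)
    (hg : InBox g E) : InBox (f * g) (D + E) := by
  classical
  intro m hm i
  obtain ⟨a, ha, b, hb, rfl⟩ := Finset.mem_add.1
    (support_coeff_mul_subset f g (Finsupp.mem_support_iff.2 hm))
  have h1 := hf a (Finsupp.mem_support_iff.1 ha) i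
  have h2 := hg b (Finsupp.mem_support_iff.1 hb) i
  push_cast
  exact (abs_add_le _ _).trans (add_le_add h1 h2)

theorem InBox.pow {f : AddMonoidAlgebra A (Fin r → ℤ)} {D : ℕ} (hf : InBox f D) (n : ℕ) :
    InBox (f ^ n) (n * D) := by
  induction n with
  | zero => simpa using inBox_one
  | succ n ih => rw [pow_succ, add_mul, one_mul]; exact ih.mul hf

theorem InBox.cartier {f : AddMonoidAlgebra A (Fin r → ℤ)} {D E q : ℕ} [NeZero q]
    (hf : InBox f D) (h : D < q * (E + 1)) : InBox (cartier q f) E := by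
  intro g hg i
  rw [coeff_cartier] at hg
  have h1 := hf _ hg i
  have hq : (0 : ℤ) < q := by exact_mod_cast Nat.pos_of_ne_zero (NeZero.ne q)
  simp only [Pi.smul_apply, nsmul_eq_mul, abs_mul, Nat.abs_cast] at h1
  have h2 : (q : ℤ) * |g i| < q * (E + 1) := h1.trans_lt (by exact_mod_cast h)
  exact Int.lt_add_one_iff.1 (lt_of_mul_lt_mul_left h2 hq.le)

theorem InBox.eq_single {f : AddMonoidAlgebra A (Fin r → ℤ)} (hf : InBox f 0) :
    f = single 0 (constTerm f) := by
  classical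
  ext g
  by_cases hg : g = 0
  · simp [hg, constTerm]
  · have : f.coeff g = 0 := by
      by_contra h
      exact hg (funext fun i => by simpa using hf g h i)
    simp [this, Ne.symm hg]

theorem exists_inBox (f : AddMonoidAlgebra A (Fin r → ℤ)) : ∃ D, InBox f D := by
  refine ⟨f.coeff.support.sup fun k => Finset.univ.sup fun i => (k i).natAbs, fun g hg i => ?_⟩
  rw [Int.abs_eq_natAbs]
  exact_mod_cast (Finset.le_sup (f := fun i => (g i).natAbs) (Finset.mem_univ i)).trans
    (Finset.le_sup (f := fun k : Fin r → ℤ => Finset.univ.sup fun i => (k i).natAbs)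
      (Finsupp.mem_support_iff.2 hg))

/-- `R ^ p` is obtained from `R` by substituting `x ^ p` for `x`. -/
def FrobeniusFixed (p : ℕ) (R : AddMonoidAlgebra A (Fin r → ℤ)) : Prop :=
  R ^ p = expand p R

variable {p : ℕ} {R Q : AddMonoidAlgebra A (Fin r → ℤ)}

theorem FrobeniusFixed.pow_pow (hR : FrobeniusFixed p R) (M : ℕ) :
    R ^ p ^ M = expand (p ^ M) R := by
  induction M with
  | zero => simp [expand_one]
  | succ M ih => rw [pow_succ, pow_mul, ih, ← map_pow, hR, expand_expand]

theorem FrobeniusFixed.constTerm_split [NeZero p] (hR : FrobeniusFixed p R) (M z t : ℕ) :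
    constTerm (R ^ (p ^ M * z + t) * Q) = constTerm (R ^ z * cartier (p ^ M) (R ^ t * Q)) := by
  rw [← cartier_expand_mul, constTerm_cartier, map_pow, ← hR.pow_pow, ← pow_mul, pow_add, mul_assoc]

/-- All exponents of R^t Q are smaller than p^M in absolute value, so the Cartier operator leaves
only the constant term. -/
theorem FrobeniusFixed.constTerm_split_of_lt [NeZero p] (hR : FrobeniusFixed p R) {D E M t : ℕ}
    (hD : InBox R D) (hE : InBox Q E) (h : t * D + E < p ^ M) (z : ℕ) :
    constTerm (R ^ (p ^ M * z + t) * Q) = constTerm (R ^ z) * constTerm (R ^ t * Q) := by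
  have hb : InBox (cartier (p ^ M) (R ^ t * Q)) 0 :=
    ((hD.pow t).mul hE).cartier (by simpa using h)
  rw [hR.constTerm_split, hb.eq_single, constTerm_cartier]
  simp [constTerm]

theorem inBox_cartier_pow_mul {D E M t : ℕ} [NeZero p]
    (hD : InBox R D) (hE : InBox Q E) (h : t < p ^ M) :
    InBox (cartier (p ^ M) (R ^ t * Q)) (D + E) := by
  refine ((hD.pow t).mul hE).cartier ?_
  have h1 : t * D ≤ p ^ M * D := Nat.mul_le_mul_right D h.le
  have h2 : E ≤ p ^ M * E := Nat.le_mul_of_pos_left E (by omega)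
  have : 0 < p ^ M := by omega
  rw [mul_add, mul_add]
  omega

/-- The digits of n and m are concatenated with enough zeros between them. -/
theorem FrobeniusFixed.exists_constTerm_mul [NeZero p] (hp : 1 < p) (hR : FrobeniusFixed p R)
    (n m : ℕ) : ∃ k, constTerm (R ^ k) = constTerm (R ^ n) * constTerm (R ^ m) := by
  obtain ⟨D, hD⟩ := exists_inBox R
  have := hR.constTerm_split_of_lt hD inBox_one (Nat.lt_pow_self hp : m * D + 0 < _) n
  exact ⟨_, by simpa using this⟩

theorem FrobeniusFixed.exists_constTerm_pow [NeZero p] (hp : 1 < p) (hR : FrobeniusFixed p R)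
    (n k : ℕ) : ∃ m, constTerm (R ^ m) = constTerm (R ^ n) ^ k := by
  induction k with
  | zero => exact ⟨0, by simp [constTerm_one]⟩
  | succ k ih =>
    obtain ⟨m, hm⟩ := ih
    obtain ⟨m', hm'⟩ := hR.exists_constTerm_mul hp m n
    exact ⟨m', by rw [hm', hm, pow_succ]⟩

/-- If some power of `R` has constant term `0`, then a single block of digits of `n` forces
`constTerm (R ^ n * Q)` to be `0`. -/
theorem FrobeniusFixed.exists_vanishing_block [NeZero p] (hp : 1 < p) (hR : FrobeniusFixed p R)
    {n₀ : ℕ} (h0 : constTerm (R ^ n₀) = 0) (E : ℕ) :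
    ∃ L W, W < p ^ L ∧ ∀ Q, InBox Q E → ∀ n k,
      n / (p ^ L) ^ k % p ^ L = W → constTerm (R ^ n * Q) = 0 := by
  obtain ⟨D, hD⟩ := exists_inBox R
  set M := n₀ + n₀ * D + (D + E) + 1 with hM
  have hlt : M < p ^ M := Nat.lt_pow_self hp
  -- The block is n₀ in M digits above M zeros. The zeros absorb the factor left by the lower
  -- digits; the zeros padding n₀ split off ct(R^n₀) = 0 from the higher digits.
  refine ⟨M + M, p ^ M * n₀, ?_, fun Q hQ n k hn => ?_⟩
  · rw [pow_add p M M]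
    exact (Nat.mul_lt_mul_left (show 0 < p ^ M by omega)).2 (by omega)
  · obtain ⟨z, hz⟩ : ∃ z, n / (p ^ (M + M)) ^ k = p ^ (M + M) * z + p ^ M * n₀ :=
      ⟨_, by rw [← hn, Nat.div_add_mod]⟩
    have hpos : 0 < p ^ ((M + M) * k) := pow_pos (by omega) _
    rw [← pow_mul] at hz
    have hE := inBox_cartier_pow_mul hD hQ (Nat.mod_lt n hpos)
    have hz' : p ^ (M + M) * z + p ^ M * n₀ = p ^ M * (p ^ M * z + n₀) + 0 := by ring
    have h1 := hR.constTerm_split_of_lt (M := M) hD inBox_one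
      (show n₀ * D + 0 < p ^ M by omega) z
    rw [mul_one, mul_one, h0, mul_zero] at h1
    rw [← Nat.div_add_mod n (p ^ ((M + M) * k)), hR.constTerm_split, hz, hz',
      hR.constTerm_split_of_lt hD hE (show 0 * D + (D + E) < p ^ M by rw [zero_mul]; omega), h1,
      zero_mul]

end Algebra

/-! ### Digit blocks, frequency and linear recurrence -/

section Combinatorics

-- The lowest digit has b - 1 admissible values, and the remaining digits again avoid W.
open Classical in
theorem card_avoid_block_mul_le {b W : ℕ} (hW : W < b) (N : ℕ) :
    ((Finset.range (b * N)).filter fun n => ∀ k, n / b ^ k % b ≠ W).card ≤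
      (b - 1) * ((Finset.range N).filter fun n => ∀ k, n / b ^ k % b ≠ W).card := by
  classical
  have hcard : ((Finset.range b).erase W).card = b - 1 := by
    rw [Finset.card_erase_of_mem (Finset.mem_range.2 hW), Finset.card_range]
  rw [← hcard, ← Finset.card_product]
  refine Finset.card_le_card_of_injOn (fun n => (n % b, n / b)) ?_ ?_
  · intro n hn
    simp only [Finset.coe_filter, Finset.mem_range, Set.mem_ofPred_eq] at hn
    simp only [Finset.coe_product, Set.mem_prod, Finset.mem_coe, Finset.mem_erase,
      Finset.mem_range, Finset.mem_filter]
    refine ⟨⟨by simpa using hn.2 0, Nat.mod_lt _ (by omega)⟩,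
      Nat.div_lt_of_lt_mul hn.1, fun k => ?_⟩
    have := hn.2 (k + 1)
    rwa [pow_succ', ← Nat.div_div_eq_div_mul] at this
  · intro n _ m _ hnm
    simp only [Prod.mk.injEq] at hnm
    rw [← Nat.div_add_mod n b, ← Nat.div_add_mod m b, hnm.1, hnm.2]

open Classical in
theorem card_avoid_block_pow_mul_le {b W : ℕ} (hW : W < b) (k N : ℕ) :
    ((Finset.range (b ^ k * N)).filter fun n => ∀ k, n / b ^ k % b ≠ W).card ≤
      (b - 1) ^ k * N := by
  induction k with
  | zero => simpa using Finset.card_filter_le (Finset.range N) _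
  | succ k ih =>
    rw [pow_succ', mul_assoc, pow_succ', mul_assoc]
    exact (card_avoid_block_mul_le hW _).trans (Nat.mul_le_mul_left _ ih)

theorem card_filter_div_le (q N : ℕ) (hq : 0 < q) (B : ℕ → Prop) [DecidablePred B] :
    ((Finset.range (q * N)).filter fun n => B (n / q)).card ≤
      q * ((Finset.range N).filter B).card := by
  classical
  conv_rhs => rw [← Finset.card_range q, ← Finset.card_product]
  refine Finset.card_le_card_of_injOn (fun n => (n % q, n / q)) ?_ ?_
  · intro n hn
    simp only [Finset.coe_filter, Finset.mem_range, Set.mem_ofPred_eq] at hn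
    simp only [Finset.coe_product, Set.mem_prod, Finset.mem_coe,
      Finset.mem_range, Finset.mem_filter]
    exact ⟨Nat.mod_lt _ hq, Nat.div_lt_of_lt_mul hn.1, hn.2⟩
  · intro n _ m _ hnm
    simp only [Prod.mk.injEq] at hnm
    rw [← Nat.div_add_mod n q, ← Nat.div_add_mod m q, hnm.1, hnm.2]

theorem ncard_eq_sub_card_filter_ne {α : Type*} [DecidableEq α] (s : ℕ → α) (c : α) (N : ℕ) :
    (Set.ncard {n : ℕ | n < N ∧ s n = c} : ℝ) =
      N - ((Finset.range N).filter fun n => s n ≠ c).card := by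
  have h1 : {n : ℕ | n < N ∧ s n = c} = ((Finset.range N).filter fun n => s n = c) := by
    ext n; simp
  have h2 := Finset.card_filter_add_card_filter_not (s := Finset.range N) (fun n => s n = c)
  rw [Finset.card_range] at h2
  rw [h1, Set.ncard_coe_finset, eq_sub_iff_add_eq]
  exact_mod_cast h2

/-- If a fixed block of base-`b` digits of `n / q` forces `s n = c`, then `c` has frequency `1`. -/
theorem hasFrequency_one_of_block {α : Type*} {s : ℕ → α} {c : α} {q b W : ℕ} (hq : 0 < q)
    (hW : W < b) (h : ∀ n k, n / q / b ^ k % b = W → s n = c) : HasFrequency s c 1 := by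
  classical
  set g : ℕ → ℕ := fun N => ((Finset.range N).filter fun n => s n ≠ c).card with hg
  have hb : 0 < b := by omega
  have hbound : ∀ k X, g X ≤ q * ((b - 1) ^ k * (X / (q * b ^ k) + 1)) := by
    intro k X
    have hX : X ≤ q * (b ^ k * (X / (q * b ^ k) + 1)) := by
      rw [← mul_assoc]
      exact (Nat.lt_mul_div_succ X (by positivity)).le
    refine le_trans (Finset.card_le_card ?_)
      ((card_filter_div_le q (b ^ k * (X / (q * b ^ k) + 1)) hq
        (fun n => ∀ k, n / b ^ k % b ≠ W)).trans
        (Nat.mul_le_mul_left q (card_avoid_block_pow_mul_le hW k _)))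
    intro n hn
    simp only [Finset.mem_filter, Finset.mem_range] at hn ⊢
    exact ⟨hn.1.trans_le hX, fun k hk => hn.2 (h n k hk)⟩
  have hzero : Tendsto (fun N : ℕ => (g N : ℝ) / N) atTop (𝓝 0) := by
    rw [Metric.tendsto_atTop]
    intro ε hε
    set θ : ℝ := ((b - 1 : ℕ) : ℝ) / b with hθ
    have hb' : (0 : ℝ) < b := by exact_mod_cast hb
    have hq' : (0 : ℝ) < q := by exact_mod_cast hq
    have hθ0 : 0 ≤ θ := by positivity
    have hθ1 : θ < 1 := by
      rw [hθ, div_lt_one hb']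
      exact_mod_cast Nat.sub_lt hb one_pos
    -- First k makes the density θ^k of the survivors small; then N₀ absorbs the rounding error
    -- q(b-1)^k, which does not depend on N.
    obtain ⟨k, hk⟩ := exists_pow_lt_of_lt_one (half_pos hε) hθ1
    obtain ⟨N₀, hN₀⟩ := exists_nat_gt (((q * (b - 1) ^ k : ℕ) : ℝ) / (ε / 2))
    refine ⟨N₀ + 1, fun N hN => ?_⟩
    have hNpos : (0 : ℝ) < N := by exact_mod_cast (by omega : 0 < N)
    have hNN : (N₀ : ℝ) < N := by exact_mod_cast (by omega : N₀ < N)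
    rw [Real.dist_eq, sub_zero, abs_of_nonneg (by positivity), div_lt_iff₀ hNpos]
    have h1 : (g N : ℝ) ≤ q * (((b - 1 : ℕ) : ℝ) ^ k * ((N : ℝ) / (q * b ^ k) + 1)) := by
      have h2 : (g N : ℝ) ≤ q * (((b - 1 : ℕ) : ℝ) ^ k * (((N / (q * b ^ k) : ℕ) : ℝ) + 1)) := by
        exact_mod_cast hbound k N
      have h3 : ((N / (q * b ^ k) : ℕ) : ℝ) ≤ (N : ℝ) / (q * b ^ k) := by
        simpa using Nat.cast_div_le (m := N) (n := q * b ^ k) (α := ℝ)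
      exact h2.trans (by gcongr)
    have h4 : q * (((b - 1 : ℕ) : ℝ) ^ k * ((N : ℝ) / (q * b ^ k) + 1)) =
        θ ^ k * N + ((q * (b - 1) ^ k : ℕ) : ℝ) := by
      rw [hθ, div_pow, Nat.cast_mul q, Nat.cast_pow]
      field_simp
    have h5 : ((q * (b - 1) ^ k : ℕ) : ℝ) < ε / 2 * N := by
      have := hN₀.trans hNN
      rwa [div_lt_iff₀ (half_pos hε), mul_comm (N : ℝ)] at this
    have h6 : θ ^ k * N ≤ ε / 2 * N := by gcongr
    linarith
  have hone : Tendsto (fun N : ℕ => (1 : ℝ) - (g N : ℝ) / N) atTop (𝓝 1) := by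
    simpa using tendsto_const_nhds.sub hzero
  refine hone.congr' ?_
  filter_upwards [eventually_gt_atTop 0] with N hN
  have : (N : ℝ) ≠ 0 := by exact_mod_cast hN.ne'
  rw [ncard_eq_sub_card_filter_ne, sub_div, div_self this]

/-- In a linearly recurrent sequence, a value with frequency `1` is the only value. -/
theorem IsLinearlyRecurrent.eq_of_hasFrequency_one {α : Type*} {s : ℕ → α} {c : α}
    (hs : IsLinearlyRecurrent s) (hc : HasFrequency s c 1) (i : ℕ) : s i = c := by
  classical
  by_contra hne
  obtain ⟨K, hK⟩ := hs
  have hrec : ∀ n, s n = s i → ∃ d, 0 < d ∧ d ≤ K ∧ s (n + d) = s i := by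
    intro n hn
    obtain ⟨d, hd0, hd, hw⟩ := hK i 1 one_pos n (by intro k hk; simpa [Nat.lt_one_iff.1 hk] using hn)
    exact ⟨d, hd0, by simpa using hd, by simpa using hw 0 one_pos⟩
  set g : ℕ → ℕ := fun N => ((Finset.range N).filter fun n => s n ≠ c).card with hg
  have hmono : Monotone g := fun a b hab =>
    Finset.card_le_card (Finset.filter_subset_filter _ (Finset.range_mono hab))
  have hcount : ∀ m, ∃ N, N ≤ i + K * m ∧ s N = s i ∧ m ≤ g N := by
    intro m
    induction m with
    | zero => exact ⟨i, by simp, rfl, Nat.zero_le _⟩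
    | succ m ih =>
      obtain ⟨N, hN, hsN, hm⟩ := ih
      obtain ⟨d, hd0, hd, hsd⟩ := hrec N hsN
      refine ⟨N + d, by rw [mul_add]; omega, hsd, ?_⟩
      have h1 : g (N + 1) = g N + 1 := by
        simp only [hg, Finset.range_add_one, Finset.filter_insert]
        rw [if_pos (by rwa [hsN]), Finset.card_insert_of_notMem (by simp)]
      have h2 : g (N + 1) ≤ g (N + d) := hmono (by omega)
      omega
  have hK0 : 0 < K := by
    obtain ⟨d, hd0, hd, -⟩ := hrec i rfl
    omega
  -- At least m + 1 positions up to i + K(m+1) ≤ (i+K)(m+1) carry a value other than c, so their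
  -- proportion cannot drop below 1/(i+K).
  have hev := hc.eventually (lt_mem_nhds (show (1 : ℝ) - 1 / (i + K) < 1 by
    have : (0 : ℝ) < i + K := by positivity
    have := one_div_pos.2 this
    linarith))
  obtain ⟨m, hm⟩ := eventually_atTop.1 hev
  have hmle : m + 1 ≤ i + K * (m + 1) := by nlinarith
  have h1 := hm (i + K * (m + 1)) (by omega)
  obtain ⟨N, hN, -, hmN⟩ := hcount (m + 1)
  have h2 : ((m + 1 : ℕ) : ℝ) ≤ g (i + K * (m + 1)) := by exact_mod_cast hmN.trans (hmono hN)
  rw [ncard_eq_sub_card_filter_ne] at h1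
  have hpos : (0 : ℝ) < ((i + K * (m + 1) : ℕ) : ℝ) := by positivity
  have hKi : (0 : ℝ) < i + K := by positivity
  rw [sub_div, div_self hpos.ne', sub_lt_sub_iff_left, div_lt_div_iff₀ hpos hKi, one_mul] at h1
  have h3 : ((m + 1 : ℕ) : ℝ) * (i + K) ≤ g (i + K * (m + 1)) * (i + K) := by gcongr
  push_cast at h1 h3
  have h4 : (0 : ℝ) ≤ m * i := by positivity
  change (g (i + K * (m + 1)) : ℝ) * (i + K) < _ at h1
  nlinarith

/-- Linear recurrence follows if every pair of consecutive blocks of length `q * p ^ L` recurs after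
boundedly many blocks. -/
theorem isLinearlyRecurrent_of_blocks {α : Type*} {s : ℕ → α} {q p K : ℕ} (hq : 0 < q) (hp : 1 < p)
    (h : ∀ L x, ∃ y, x < y ∧ y ≤ x + K ∧
      ∀ t < 2 * (q * p ^ L), s (q * p ^ L * y + t) = s (q * p ^ L * x + t)) :
    IsLinearlyRecurrent s := by
  refine ⟨q * p * K, fun i ℓ hℓ j hj => ?_⟩
  -- With ℓ < p^L ≤ pℓ, any word of length ℓ fits into two consecutive blocks, and the block length
  -- is still at most qpℓ.
  set L := Nat.log p ℓ + 1 with hL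
  have h1 : ℓ < p ^ L := Nat.lt_pow_succ_log_self hp ℓ
  have h2 : p ^ L ≤ p * ℓ := by
    rw [hL, pow_succ']
    exact Nat.mul_le_mul_left p (Nat.pow_log_le_self p hℓ.ne')
  set B := q * p ^ L with hB
  have hBpos : 0 < B := Nat.mul_pos hq (by omega)
  have hℓB : ℓ < B := h1.trans_le (Nat.le_mul_of_pos_left _ hq)
  obtain ⟨y, hxy, hyK, hy⟩ := h L (j / B)
  obtain ⟨e, rfl⟩ := Nat.exists_eq_add_of_lt hxy
  refine ⟨B * (e + 1), by positivity, ?_, fun k hk => ?_⟩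
  · calc B * (e + 1) ≤ (q * (p * ℓ)) * K :=
          Nat.mul_le_mul (Nat.mul_le_mul_left q h2) (by omega)
      _ = q * p * K * ℓ := by ring
  · have hmod := Nat.mod_lt j hBpos
    have h3 := hy (j % B + k) (by omega)
    have hdm := Nat.div_add_mod j B
    have e1 : B * (j / B + e + 1) + (j % B + k) = j + B * (e + 1) + k := by
      nth_rw 3 [← hdm]; ring
    have e2 : B * (j / B) + (j % B + k) = j + k := by
      nth_rw 3 [← hdm]; ring
    rw [e1, e2] at h3
    rw [h3, hj k hk]

theorem exists_uniform_bound {ι β : Type*} [Finite β] (f : ι → β) (S : β → ℕ → Prop)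
    (hmono : ∀ b N N', N ≤ N' → S b N → S b N') (h : ∀ x, ∃ N, S (f x) N) :
    ∃ N, ∀ x, S (f x) N := by
  have h' : ∀ b, ∃ N, ∀ x, f x = b → S b N := by
    intro b
    by_cases hb : ∃ x, f x = b
    · obtain ⟨x, rfl⟩ := hb
      obtain ⟨N, hN⟩ := h x
      exact ⟨N, fun _ _ => hN⟩
    · exact ⟨0, fun x hx => (hb ⟨x, hx⟩).elim⟩
  choose N hN using h'
  obtain ⟨M, hM⟩ := (Set.finite_range N).bddAbove
  exact ⟨M, fun x => hmono _ _ _ (hM ⟨f x, rfl⟩) (hN (f x) x rfl)⟩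

end Combinatorics

/-! ### Bounded recurrence and the finite check -/

section Recurrence

open AddMonoidAlgebra

variable {A : Type*} [CommRing A] {r p : ℕ} {P R : AddMonoidAlgebra A (Fin r → ℤ)}

/-- The coefficients of a Laurent polynomial in the box of radius `m`. -/
def boxCoeff (m : ℕ) (f : AddMonoidAlgebra A (Fin r → ℤ)) : (Fin r → Fin (2 * m + 1)) → A :=
  fun g => f.coeff fun i => (g i : ℤ) - m

theorem boxCoeff_injOn (m : ℕ) :
    Set.InjOn (boxCoeff m) {f : AddMonoidAlgebra A (Fin r → ℤ) | InBox f m} := by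
  intro f hf f' hf' h
  ext g
  by_cases hg : ∀ i, |g i| ≤ (m : ℤ)
  · have := congrFun h fun i => ⟨(g i + m).toNat, by have := abs_le.1 (hg i); omega⟩
    have hgi : (fun i => (((g i + m).toNat : ℕ) : ℤ) - m) = g := by
      funext i
      have := abs_le.1 (hg i)
      omega
    simpa only [boxCoeff, hgi] using this
  · have h1 : f.coeff g = 0 := by by_contra h0; exact hg (hf g h0)
    have h2 : f'.coeff g = 0 := by by_contra h0; exact hg (hf' g h0)
    rw [h1, h2]

theorem finite_inBox [Finite A] (m : ℕ) :
    Finite {f : AddMonoidAlgebra A (Fin r → ℤ) // InBox f m} :=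
  Finite.of_injective (fun f => boxCoeff m f.1) fun f f' h =>
    Subtype.ext (boxCoeff_injOn m f.2 f'.2 h)

/-- A unit of a finite ring has finite order, so its inverse is a power of it and hence a constant
term again. Finitely many units give a common bound. -/
theorem FrobeniusFixed.exists_bounded_inverse [Finite A] [NeZero p] (hp : 1 < p)
    (hR : FrobeniusFixed p R) (hu : ∀ n, IsUnit (constTerm (R ^ n))) :
    ∃ N, ∀ z, ∃ m ≤ N, constTerm (R ^ z) * constTerm (R ^ m) = 1 := by
  refine exists_uniform_bound (fun z => constTerm (R ^ z))
    (fun c N => ∃ m ≤ N, c * constTerm (R ^ m) = 1)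
    (fun c N N' hN ⟨m, hm, h⟩ => ⟨m, hm.trans hN, h⟩) fun z => ?_
  obtain ⟨u, hu⟩ := hu z
  obtain ⟨k, hk, hk1⟩ := isOfFinOrder_iff_pow_eq_one.1 (isOfFinOrder_of_finite u)
  obtain ⟨m, hm⟩ := hR.exists_constTerm_pow hp z (k - 1)
  refine ⟨m, m, le_rfl, ?_⟩
  rw [hm, ← pow_succ', Nat.sub_add_cancel hk, ← hu, ← Units.val_pow_eq_pow_val, hk1, Units.val_one]

/-- The functional `Q ↦ constTerm (R ^ x * Q)` on a box reappears in every window of bounded length,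
with a bound that may depend on `x`. -/
theorem FrobeniusFixed.exists_recurrence_of_functional [Finite A] [NeZero p] (hp : 1 < p)
    (hR : FrobeniusFixed p R) (hu : ∀ n, IsUnit (constTerm (R ^ n))) (E x : ℕ) :
    ∃ K, ∀ w, ∃ y, w < y ∧ y ≤ w + K ∧
      ∀ Q, InBox Q E → constTerm (R ^ y * Q) = constTerm (R ^ x * Q) := by
  obtain ⟨D, hD⟩ := exists_inBox R
  obtain ⟨N, hN⟩ := hR.exists_bounded_inverse hp hu
  set M := x + x * D + E with hM
  set M' := N + N * D with hM'
  have hlt : M < p ^ M := Nat.lt_pow_self hp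
  have hlt' : M' < p ^ M' := Nat.lt_pow_self hp
  have hT : 0 < p ^ (M + M') := pow_pos (by omega) _
  refine ⟨2 * p ^ (M + M'), fun w => ?_⟩
  -- Taking z just above w / p^(M+M') puts the new exponent beyond w. Its digits are z, then m, then
  -- x, padded so that the value is ct(R^z) ct(R^m) ct(R^x Q) with the first two factors cancelling.
  obtain ⟨m, hmN, hm⟩ := hN (w / p ^ (M + M') + 1)
  have hmD : m * D ≤ N * D := Nat.mul_le_mul_right D hmN
  set z := w / p ^ (M + M') + 1 with hz
  have hy : p ^ M * (p ^ M' * z + m) + x = p ^ (M + M') * z + (p ^ M * m + x) := by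
    rw [pow_add p M M']; ring
  have hsmall : p ^ M * m + x < p ^ (M + M') := by
    rw [pow_add p M M']
    calc p ^ M * m + x < p ^ M * (m + 1) := by rw [mul_add]; omega
      _ ≤ p ^ M * p ^ M' := Nat.mul_le_mul_left _ (by omega)
  have hdm := Nat.div_add_mod w (p ^ (M + M'))
  have hmod := Nat.mod_lt w hT
  have hzw : p ^ (M + M') * z = p ^ (M + M') * (w / p ^ (M + M')) + p ^ (M + M') := by
    rw [hz, mul_add, mul_one]
  have hbounds : w < p ^ M * (p ^ M' * z + m) + x ∧
      p ^ M * (p ^ M' * z + m) + x ≤ w + 2 * p ^ (M + M') := by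
    rw [hy, hzw]
    clear_value z M M'
    generalize p ^ (M + M') = T at *
    omega
  refine ⟨p ^ M * (p ^ M' * z + m) + x, hbounds.1, hbounds.2, fun Q hQ => ?_⟩
  have h1 := hR.constTerm_split_of_lt (M := M') hD inBox_one (show m * D + 0 < p ^ M' by omega) z
  rw [mul_one, mul_one, hm] at h1
  rw [hR.constTerm_split_of_lt hD hQ (by omega), h1, one_mul]

/-- The box contains finitely many polynomials over a finite ring, so there are finitely many
functionals and the largest of their gap bounds serves for all x. -/
theorem FrobeniusFixed.exists_uniform_recurrence_of_functional [Finite A] [NeZero p] (hp : 1 < p)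
    (hR : FrobeniusFixed p R) (hu : ∀ n, IsUnit (constTerm (R ^ n))) (E : ℕ) :
    ∃ K, ∀ x, ∃ y, x < y ∧ y ≤ x + K ∧
      ∀ Q, InBox Q E → constTerm (R ^ y * Q) = constTerm (R ^ x * Q) := by
  have := finite_inBox (A := A) (r := r) E
  obtain ⟨K, hK⟩ := exists_uniform_bound
    (fun (x : ℕ) (Q : {f : AddMonoidAlgebra A (Fin r → ℤ) // InBox f E}) =>
      constTerm (R ^ x * Q.1))
    (fun φ K => ∀ w, ∃ y, w < y ∧ y ≤ w + K ∧
      ∀ Q (hQ : InBox Q E), constTerm (R ^ y * Q) = φ ⟨Q, hQ⟩)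
    (fun φ N N' hN h w => by
      obtain ⟨y, h1, h2, h3⟩ := h w
      exact ⟨y, h1, by omega, h3⟩)
    (fun x => hR.exists_recurrence_of_functional hp hu E x)
  exact ⟨K, fun x => hK x x⟩

theorem FrobeniusFixed.isLinearlyRecurrent [Finite A] [NeZero p] (hp : 1 < p) {q : ℕ} (hq : 0 < q)
    (hR : FrobeniusFixed p (P ^ q)) (hu : ∀ n, IsUnit (constTerm ((P ^ q) ^ n)))
    (Q : AddMonoidAlgebra A (Fin r → ℤ)) :
    IsLinearlyRecurrent fun n => constTerm (P ^ n * Q) := by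
  obtain ⟨D, hD⟩ := exists_inBox P
  obtain ⟨E, hE⟩ := exists_inBox Q
  have hRD : InBox (P ^ q) (q * D) := hD.pow q
  -- Beyond E, one qD bounds P^(t % q), one is added by the Cartier step, and one by the extra
  -- factor R needed in the second block.
  obtain ⟨K, hK⟩ := hR.exists_uniform_recurrence_of_functional hp hu
    (q * D + (q * D + (q * D + E)))
  refine isLinearlyRecurrent_of_blocks hq hp (K := K) fun L x => ?_
  obtain ⟨y, hxy, hyK, hy⟩ := hK x
  refine ⟨y, hxy, hyK, fun t ht => ?_⟩
  have hpL : 0 < p ^ L := pow_pos (by omega) L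
  have hj := Nat.mod_lt t hq
  have hQ' : InBox (P ^ (t % q) * Q) (q * D + E) :=
    ((hD.pow _).mul hE).mono (Nat.add_le_add_right (Nat.mul_le_mul_right D hj.le) E)
  have hform : ∀ x, P ^ (q * p ^ L * x + t) * Q =
      (P ^ q) ^ (p ^ L * x + t / q) * (P ^ (t % q) * Q) := by
    intro x
    rw [← mul_assoc, ← pow_mul, ← pow_add]
    congr 2
    conv_lhs => rw [← Nat.div_add_mod t q]
    ring
  simp only [hform]
  have ht' : t / q < 2 * p ^ L := Nat.div_lt_of_lt_mul (by rwa [mul_left_comm] at ht)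
  rcases lt_or_ge (t / q) (p ^ L) with h | h
  · rw [hR.constTerm_split, hR.constTerm_split]
    exact hy _ ((inBox_cartier_pow_mul hRD hQ' h).mono (by omega))
  -- In the second block the exponent is x + 1; one factor R moves into the argument of the
  -- functional at x.
  · obtain ⟨u, hu⟩ := Nat.exists_eq_add_of_le h
    have hexp : ∀ x, p ^ L * x + t / q = p ^ L * (x + 1) + u := fun x => by rw [hu]; ring
    rw [hexp, hexp, hR.constTerm_split, hR.constTerm_split, pow_succ, pow_succ, mul_assoc, mul_assoc]
    exact hy _ (hRD.mul (inBox_cartier_pow_mul hRD hQ' (by omega)))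

theorem FrobeniusFixed.hasFrequency_zero [NeZero p] (hp : 1 < p) {q : ℕ} (hq : 0 < q)
    (hR : FrobeniusFixed p (P ^ q)) {n₀ : ℕ} (h0 : constTerm ((P ^ q) ^ n₀) = 0)
    (Q : AddMonoidAlgebra A (Fin r → ℤ)) :
    HasFrequency (fun n => constTerm (P ^ n * Q)) 0 1 := by
  obtain ⟨D, hD⟩ := exists_inBox P
  obtain ⟨E, hE⟩ := exists_inBox Q
  obtain ⟨L, W, hW, hz⟩ := hR.exists_vanishing_block hp h0 (q * D + E)
  refine hasFrequency_one_of_block hq hW fun n k hn => ?_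
  have h1 := hz (P ^ (n % q) * Q) (((hD.pow _).mul hE).mono
    (Nat.add_le_add_right (Nat.mul_le_mul_right D (Nat.mod_lt n hq).le) E)) (n / q) k hn
  rwa [← mul_assoc, ← pow_mul, ← pow_add, Nat.div_add_mod] at h1

/-- Every value of `constTerm (R ^ n)` is attained at an `n` bounded in terms of the number of
possible states of the automaton. -/
theorem FrobeniusFixed.exists_lt_constTerm_eq [Finite A] [NeZero p] (hp : 1 < p)
    (hR : FrobeniusFixed p R) {D : ℕ} (hD : InBox R D) (n : ℕ) :
    ∃ n' < p ^ (Nat.card A ^ ((2 * (D - 1) + 1) ^ r)),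
      constTerm (R ^ n') = constTerm (R ^ n) := by
  classical
  have := Fintype.ofFinite A
  induction n using Nat.strong_induction_on with
  | _ n ih =>
  set S := Nat.card A ^ ((2 * (D - 1) + 1) ^ r) with hS
  rcases lt_or_ge n (p ^ S) with hn | hn
  · exact ⟨n, hn, rfl⟩
  -- Since n % p^k < p^k strictly, the radius is D - 1 rather than D when D > 0.
  have hbox : ∀ k, InBox (cartier (p ^ k) (R ^ (n % p ^ k) * 1)) (D - 1) := by
    intro k
    have hpos : 0 < p ^ k := pow_pos (by omega) k
    have hlt := Nat.mod_lt n hpos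
    refine ((hD.pow _).mul inBox_one).cartier ?_
    rcases Nat.eq_zero_or_pos D with rfl | hD0
    · simpa using hpos
    · rw [Nat.sub_add_cancel hD0, add_zero]
      exact Nat.mul_lt_mul_of_pos_right hlt hD0
  -- There are S + 1 cut positions and at most S coefficient vectors, so two cuts leave the same
  -- factor; the digits between them can be deleted.
  obtain ⟨k₁, k₂, hk, heq⟩ : ∃ k₁ k₂ : Fin (S + 1), k₁ < k₂ ∧
      boxCoeff (D - 1) (cartier (p ^ (k₁ : ℕ)) (R ^ (n % p ^ (k₁ : ℕ)) * 1)) =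
      boxCoeff (D - 1) (cartier (p ^ (k₂ : ℕ)) (R ^ (n % p ^ (k₂ : ℕ)) * 1)) := by
    obtain ⟨a, b, hab, h⟩ := Fintype.exists_ne_map_eq_of_card_lt
      (fun k : Fin (S + 1) =>
        boxCoeff (D - 1) (cartier (p ^ (k : ℕ)) (R ^ (n % p ^ (k : ℕ)) * 1)))
      (by simp [hS, Nat.card_eq_fintype_card])
    rcases lt_or_gt_of_ne hab with hlt | hlt
    · exact ⟨a, b, hlt, h⟩
    · exact ⟨b, a, hlt, h.symm⟩
  have hst := boxCoeff_injOn (D - 1) (hbox k₁) (hbox k₂) heq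
  have hk' : (k₁ : ℕ) + 1 ≤ k₂ := hk
  have hval : constTerm (R ^ (p ^ (k₁ : ℕ) * (n / p ^ (k₂ : ℕ)) + n % p ^ (k₁ : ℕ))) =
      constTerm (R ^ n) := by
    conv_rhs => rw [← Nat.div_add_mod n (p ^ (k₂ : ℕ)), ← mul_one (R ^ _), hR.constTerm_split]
    rw [← mul_one (R ^ _), hR.constTerm_split, hst]
  have hless : p ^ (k₁ : ℕ) * (n / p ^ (k₂ : ℕ)) + n % p ^ (k₁ : ℕ) < n := by
    have hpos1 : 0 < p ^ (k₁ : ℕ) := pow_pos (by omega) _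
    have hpos2 : 0 < p ^ (k₂ : ℕ) := pow_pos (by omega) _
    have hm := Nat.mod_lt n hpos1
    -- As k₂ ≤ S and n ≥ p^S, the part above the cut is nonzero, so the deletion strictly decreases
    -- n.
    have hz : 1 ≤ n / p ^ (k₂ : ℕ) := (Nat.one_le_div_iff hpos2).2
      ((Nat.pow_le_pow_right (by omega) (Nat.lt_succ_iff.1 k₂.2)).trans hn)
    have h2 : p ^ (k₁ : ℕ) * 2 ≤ p ^ (k₂ : ℕ) :=
      (Nat.mul_le_mul_left _ hp).trans
        (by rw [← pow_succ]; exact Nat.pow_le_pow_right (by omega) hk')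
    have h3 : p ^ (k₁ : ℕ) * 2 * (n / p ^ (k₂ : ℕ)) ≤ n :=
      (Nat.mul_le_mul_right _ h2).trans (Nat.mul_div_le n _)
    have h4 : p ^ (k₁ : ℕ) ≤ p ^ (k₁ : ℕ) * (n / p ^ (k₂ : ℕ)) := Nat.le_mul_of_pos_right _ hz
    have h5 : p ^ (k₁ : ℕ) * 2 * (n / p ^ (k₂ : ℕ)) =
      p ^ (k₁ : ℕ) * (n / p ^ (k₂ : ℕ)) + p ^ (k₁ : ℕ) * (n / p ^ (k₂ : ℕ)) := by ring
    omega
  obtain ⟨n', hn', h⟩ := ih _ hless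
  exact ⟨n', hn', h.trans hval⟩

end Recurrence

/-! ### Reduction modulo prime powers -/

open AddMonoidAlgebra

variable {r : ℕ}

/-- Reduction of the coefficients modulo `N`. -/
noncomputable def reduce (N : ℕ) : IntLaurent r →+* AddMonoidAlgebra (ZMod N) (Fin r → ℤ) :=
  mapRingHom (Fin r → ℤ) (Int.castRingHom (ZMod N))

theorem constTerm_reduce (N : ℕ) (f : IntLaurent r) :
    constTerm (reduce N f) = (IntLaurent.ct f : ZMod N) := by
  simp [constTerm, reduce, IntLaurent.ct]

theorem ctSeq_eq (P Q : IntLaurent r) (N : ℕ) :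
    IntLaurent.ctSeq P Q N = fun n => constTerm (reduce N P ^ n * reduce N Q) := by
  funext n
  rw [IntLaurent.ctSeq, ← constTerm_reduce, map_mul, map_pow]

theorem reduce_expand (N q : ℕ) (f : IntLaurent r) :
    reduce N (expand q f) = expand q (reduce N f) := by
  induction f using AddMonoidAlgebra.induction_linear with
  | zero => simp
  | add f g hf hg => simp [hf, hg]
  | single g c => simp [reduce, expand_single]

/-- Additivity of the p-th power mod p reduces this to monomials, where it is Fermat's little
theorem. -/
theorem dvd_pow_sub_expand {p : ℕ} (hp : p.Prime) (f : IntLaurent r) :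
    (p : IntLaurent r) ∣ f ^ p - expand p f := by
  induction f using AddMonoidAlgebra.induction_linear with
  | zero => simp [hp.ne_zero]
  | add f g hf hg =>
    obtain ⟨h, hh⟩ := exists_add_pow_prime_eq hp f g
    have : (f + g) ^ p - expand p (f + g) =
        (f ^ p - expand p f) + (g ^ p - expand p g) + p * (f * g * h) := by
      rw [hh, map_add]; ring
    rw [this]
    exact dvd_add (dvd_add hf hg) (dvd_mul_right _ _)
  | single g c =>
    have : Fact p.Prime := ⟨hp⟩
    have hc : (p : ℤ) ∣ c ^ p - c := by
      rw [← ZMod.intCast_zmod_eq_zero_iff_dvd]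
      simp [ZMod.pow_card]
    obtain ⟨d, hd⟩ := hc
    refine ⟨single (p • g) d, ?_⟩
    rw [expand_single, AddMonoidAlgebra.single_pow, ← AddMonoidAlgebra.single_sub, hd,
      AddMonoidAlgebra.natCast_def, AddMonoidAlgebra.single_mul_single, zero_add]

/-- Raising the congruence P^p ≡ P(x^p) mod p to the power p^k lifts it to a congruence mod p^(k+1).
-/
theorem frobeniusFixed_reduce {p : ℕ} (hp : p.Prime) (P : IntLaurent r) (k : ℕ) :
    FrobeniusFixed p (reduce (p ^ (k + 1)) P ^ p ^ k) := by
  obtain ⟨h, hh⟩ := dvd_sub_pow_of_dvd_sub (dvd_pow_sub_expand hp P) k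
  have h1 := congrArg (reduce (p ^ (k + 1))) hh
  have h0 : ((p : AddMonoidAlgebra (ZMod (p ^ (k + 1))) (Fin r → ℤ))) ^ (k + 1) = 0 := by
    rw [← Nat.cast_pow, AddMonoidAlgebra.natCast_def, ZMod.natCast_self,
      AddMonoidAlgebra.single_zero]
  rw [map_mul, map_pow, map_natCast, h0, zero_mul, map_sub, sub_eq_zero, map_pow, map_pow, map_pow,
    reduce_expand] at h1
  rw [FrobeniusFixed, map_pow, ← h1, pow_right_comm]

theorem inBox_reduce (N : ℕ) (P : IntLaurent r) : InBox (reduce N P) (IntLaurent.deg P) := by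
  intro g hg i
  have hg' : P.coeff g ≠ 0 := by
    intro h
    exact hg (by simp [reduce, h])
  rw [Int.abs_eq_natAbs]
  exact_mod_cast (Finset.le_sup (f := fun i => (g i).natAbs) (Finset.mem_univ i)).trans
    (Finset.le_sup (f := fun k : Fin r → ℤ => Finset.univ.sup fun i => (k i).natAbs)
      (Finsupp.mem_support_iff.2 hg'))

theorem dvd_ct_pow_iff {p : ℕ} (P : IntLaurent r) (n : ℕ) :
    (p : ℤ) ∣ IntLaurent.ct (P ^ n) ↔ constTerm (reduce p P ^ n) = 0 := by
  rw [← map_pow, constTerm_reduce, ZMod.intCast_zmod_eq_zero_iff_dvd]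

theorem frobeniusFixed_reduce_prime {p : ℕ} (hp : p.Prime) (P : IntLaurent r) :
    FrobeniusFixed p (reduce p P) := by
  have := frobeniusFixed_reduce hp P 0
  rwa [zero_add, pow_one, pow_zero, pow_one] at this

theorem forall_not_dvd_ct_iff {p : ℕ} (hp : p.Prime) (P : IntLaurent r) :
    (∀ n : ℕ, ¬ (p : ℤ) ∣ IntLaurent.ct (P ^ n)) ↔
      ∀ n < IntLaurent.checkBound P p, ¬ (p : ℤ) ∣ IntLaurent.ct (P ^ n) := by
  have : NeZero p := ⟨hp.ne_zero⟩
  refine ⟨fun h n _ => h n, fun h n hn => ?_⟩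
  obtain ⟨n', hn', heq⟩ := (frobeniusFixed_reduce_prime hp P).exists_lt_constTerm_eq hp.one_lt
    (inBox_reduce p P) n
  rw [Nat.card_zmod] at hn'
  exact h n' hn' ((dvd_ct_pow_iff P n').2 (heq.trans ((dvd_ct_pow_iff P n).1 hn)))

/-- Appending zero digits leaves the constant term unchanged mod p. This carries divisibility over
from P to R = P^(p^k). -/
theorem dvd_ct_pow_prime_pow_mul_iff {p : ℕ} (hp : p.Prime) (P : IntLaurent r) (k n : ℕ) :
    (p : ℤ) ∣ IntLaurent.ct (P ^ (p ^ k * n)) ↔ (p : ℤ) ∣ IntLaurent.ct (P ^ n) := by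
  have : NeZero p := ⟨hp.ne_zero⟩
  have h := (frobeniusFixed_reduce_prime hp P).constTerm_split_of_lt (M := k) (t := 0)
    (inBox_reduce p P) inBox_one (by simpa using pow_pos hp.pos k) n
  simp only [add_zero, mul_one, pow_zero, constTerm_one] at h
  rw [dvd_ct_pow_iff, dvd_ct_pow_iff, h]

theorem isLinearlyRecurrent_ctSeq {p : ℕ} (hp : p.Prime) (P Q : IntLaurent r) {a : ℕ} (ha : 1 ≤ a)
    (h : ∀ n : ℕ, ¬ (p : ℤ) ∣ IntLaurent.ct (P ^ n)) :
    IsLinearlyRecurrent (IntLaurent.ctSeq P Q (p ^ a)) := by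
  obtain ⟨k, rfl⟩ := Nat.exists_eq_add_of_le' ha
  have : NeZero p := ⟨hp.ne_zero⟩
  rw [ctSeq_eq]
  refine (frobeniusFixed_reduce hp P k).isLinearlyRecurrent hp.one_lt (pow_pos hp.pos k)
    (fun n => ?_) _
  rw [← map_pow, ← map_pow, constTerm_reduce, ZMod.coe_int_isUnit_iff_isCoprime, ← pow_mul]
  push_cast
  exact IsCoprime.pow_left ((Nat.prime_iff_prime_int.1 hp).coprime_iff_not_dvd.2 (h _))

theorem hasFrequency_zero_ctSeq {p : ℕ} (hp : p.Prime) (P Q : IntLaurent r) {a : ℕ} (ha : 1 ≤ a)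
    (h : ∃ n : ℕ, (p : ℤ) ∣ IntLaurent.ct (P ^ n)) :
    HasFrequency (IntLaurent.ctSeq P Q (p ^ a)) 0 1 := by
  obtain ⟨k, rfl⟩ := Nat.exists_eq_add_of_le' ha
  obtain ⟨n, hn⟩ := h
  have : NeZero p := ⟨hp.ne_zero⟩
  have hR := frobeniusFixed_reduce hp P k
  -- A multiple of p raised to the power k + 1 vanishes mod p^(k+1).
  obtain ⟨m, hm⟩ := hR.exists_constTerm_pow hp.one_lt n (k + 1)
  rw [ctSeq_eq]
  refine hR.hasFrequency_zero hp.one_lt (pow_pos hp.pos k) (n₀ := m) ?_ _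
  rw [hm, ← map_pow, ← map_pow, constTerm_reduce, ← Int.cast_pow,
    ZMod.intCast_zmod_eq_zero_iff_dvd, ← pow_mul, Nat.cast_pow]
  exact pow_dvd_pow_of_dvd ((dvd_ct_pow_prime_pow_mul_iff hp P k n).2 hn) _

end LaurentCT

theorem theorem5 (r : ℕ) (P : IntLaurent r) (p : ℕ) (hp : p.Prime) :
    -- the divisibility condition, which involves neither `Q` nor `a`, can be checked for bounded `n`
    ((∀ n : ℕ, ¬ (p : ℤ) ∣ IntLaurent.ct (P ^ n)) ↔
      ∀ n < IntLaurent.checkBound P p, ¬ (p : ℤ) ∣ IntLaurent.ct (P ^ n)) ∧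
    ∀ (Q : IntLaurent r) (a : ℕ), 1 ≤ a →
      -- the characterization, for sequences that are not identically zero
      ((∃ n, IntLaurent.ctSeq P Q (p ^ a) n ≠ 0) →
        (IsLinearlyRecurrent (IntLaurent.ctSeq P Q (p ^ a)) ↔
          ∀ n : ℕ, ¬ (p : ℤ) ∣ IntLaurent.ct (P ^ n))) ∧
      -- the two halves of the dichotomy, which hold for every `Q`
      ((∀ n : ℕ, ¬ (p : ℤ) ∣ IntLaurent.ct (P ^ n)) →
        IsLinearlyRecurrent (IntLaurent.ctSeq P Q (p ^ a))) ∧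
      ((∃ n : ℕ, (p : ℤ) ∣ IntLaurent.ct (P ^ n)) →
        HasFrequency (IntLaurent.ctSeq P Q (p ^ a)) 0 1) ∧
      (¬ IsLinearlyRecurrent (IntLaurent.ctSeq P Q (p ^ a)) →
        HasFrequency (IntLaurent.ctSeq P Q (p ^ a)) 0 1) := by
  refine ⟨LaurentCT.forall_not_dvd_ct_iff hp P, fun Q a ha => ?_⟩
  have hrec := LaurentCT.isLinearlyRecurrent_ctSeq hp P Q ha
  have hfreq := LaurentCT.hasFrequency_zero_ctSeq hp P Q ha
  refine ⟨fun ⟨n, hn⟩ => ⟨fun hlr m hm => ?_, hrec⟩, hrec, hfreq, fun hlr => hfreq ?_⟩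
  · exact hn (LaurentCT.IsLinearlyRecurrent.eq_of_hasFrequency_one hlr (hfreq ⟨m, hm⟩) n)
  · by_contra hne
    exact hlr (hrec (not_exists.1 hne))
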